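/- **Theorem 4.3.** Let $\mathcal T=(V,E,F)$ be an infinite disk triangulation, that is, a locally finite simplicial triangulation, with infinitely many vertices, of a simply connected surface without boundary that has exactly one end, and let $\Phi\in[0,\frac{\pi}{2}]^E$. For $u\in(-\infty,0)^V$ let $r_i>0$ be determined by $u_i=\ln\tanh\frac{r_i}{2}$, and give each edge $\{i,j\}\in E$ the length $$l_{ij}=\cosh^{-1}\bigl(\cosh r_i\cosh r_j+\cos\Phi_{ij}\,\sinh r_i\sinh r_j\bigr).$$ Then $u$ is called the discrete conformal factor of the hyperbolic circle-packing metric $r$, and its discrete Gaussian curvature at $i\in V$ is $$K_i(u)=2\pi-\sum_{\{i,j,k\}\in F}\theta_i^{jk},$$ where $\theta_i^{jk}$ is the inner angle at $i$ of the hyperbolic triangle with side lengths $l_{ij},l_{jk},l_{ik}$. If $u_0\in(-\infty,0)^V$ and $\hat K\in\mathbb R^V$ satisfy $K_i(u_0)\le\hat K_i<2\pi$ for all $i\in V$, then there exists $u^*\in(-\infty,0)^V$ such that $K_i(u^*)=\hat K_i$ for all $i\in V$. -/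

import Mathlib

noncomputable section

namespace CirclePacking

variable {V : Type*}

/-- `{i, j, k}` is a two-dimensional face of `T` (so `i`, `j`, `k` are distinct). -/
def IsTriangle (T : AbstractSimplicialComplex V) (i j k : V) : Prop :=
  ∃ f ∈ T.faces, f.card = 3 ∧ (f : Set V) = {i, j, k}

/-- The 1-skeleton of `T`: vertices `i ≠ j` are adjacent iff `{i, j}` is an edge of `T`. -/
def skeleton (T : AbstractSimplicialComplex V) : SimpleGraph V where
  Adj i j := i ≠ j ∧ ∃ f ∈ T.faces, (f : Set V) = {i, j}
  symm := by
    constructor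
    rintro i j ⟨hne, f, hf, h⟩
    exact ⟨hne.symm, f, hf, by rw [h, Set.pair_comm]⟩
  loopless := ⟨fun _ h => h.1 rfl⟩

/-- Every vertex lies in only finitely many simplices. -/
def LocallyFinite (T : AbstractSimplicialComplex V) : Prop :=
  ∀ i : V, {f : Finset V | f ∈ T.faces ∧ i ∈ f}.Finite

/-- The geometric realization of `T` in barycentric coordinates, as a subspace of `V → ℝ`
(product topology). For a locally finite complex this topology is the usual (weak) one. -/
def Realization (T : AbstractSimplicialComplex V) : Type _ :=
  {x : V → ℝ // (∀ v, 0 ≤ x v) ∧ ∃ f ∈ T.faces, (∀ v ∉ f, x v = 0) ∧ ∑ v ∈ f, x v = 1}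

instance (T : AbstractSimplicialComplex V) : TopologicalSpace (Realization T) :=
  inferInstanceAs (TopologicalSpace {x : V → ℝ // (∀ v, 0 ≤ x v) ∧
    ∃ f ∈ T.faces, (∀ v ∉ f, x v = 0) ∧ ∑ v ∈ f, x v = 1})

/-- An infinite disk triangulation: a locally finite triangulation, with infinitely many vertices,
of a simply connected surface (without boundary) that has exactly one end. The surface is the
geometric realization. It is Hausdorff by construction, and second countable because the complex
is connected and locally finite. The ends of the triangulation are those of its locally finite
1-skeleton. -/
structure IsInfiniteDiskTriangulation (T : AbstractSimplicialComplex V) : Prop where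
  infinite : Infinite V
  locallyFinite : LocallyFinite T
  surface : Nonempty (ChartedSpace (EuclideanSpace ℝ (Fin 2)) (Realization T))
  simplyConnected : SimplyConnectedSpace (Realization T)
  one_end : ∃! e, e ∈ (skeleton T).end

/-- Hyperbolic length of the edge `{i, j}` for the radii `r` and intersection angles `Φ`. -/
def edgeLength (Φ : Sym2 V → ℝ) (r : V → ℝ) (i j : V) : ℝ :=
  Real.arcosh (Real.cosh (r i) * Real.cosh (r j) +
    Real.cos (Φ s(i, j)) * Real.sinh (r i) * Real.sinh (r j))

lemma edgeLength_comm (Φ : Sym2 V → ℝ) (r : V → ℝ) (i j : V) :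
    edgeLength Φ r i j = edgeLength Φ r j i := by
  unfold edgeLength
  rw [Sym2.eq_swap]
  ring_nf

/-- The inner angle at the vertex with adjacent sides `b`, `c` and opposite side `a` of a
hyperbolic triangle (hyperbolic law of cosines). -/
def hyperbolicAngle (a b c : ℝ) : ℝ :=
  Real.arccos ((Real.cosh b * Real.cosh c - Real.cosh a) / (Real.sinh b * Real.sinh c))

/-- The inner angle at `i` of the triangle `{i, j, k}`, as a function of the pair `{j, k}`. -/
def innerAngle (Φ : Sym2 V → ℝ) (r : V → ℝ) (i : V) : Sym2 V → ℝ :=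
  Sym2.lift ⟨fun j k =>
    hyperbolicAngle (edgeLength Φ r j k) (edgeLength Φ r i j) (edgeLength Φ r i k), by
      intro j k
      simp only [hyperbolicAngle]
      rw [edgeLength_comm Φ r j k, mul_comm (Real.cosh (edgeLength Φ r i j)),
        mul_comm (Real.sinh (edgeLength Φ r i j))]⟩

/-- The pairs `{j, k}` such that `{i, j, k}` is a face; they correspond to the faces at `i`. -/
def oppositeEdges (T : AbstractSimplicialComplex V) (i : V) : Set (Sym2 V) :=
  {e | ∃ j k, e = s(j, k) ∧ IsTriangle T i j k}

/-- The radius `r` with discrete conformal factor `u = ln (tanh (r / 2)) < 0`. -/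
def radius (u : ℝ) : ℝ := 2 * Real.artanh (Real.exp u)

lemma radius_pos {u : ℝ} (hu : u < 0) : 0 < radius u :=
  mul_pos two_pos (Real.artanh_pos ⟨Real.exp_pos u, by simpa using hu⟩)

lemma log_tanh_radius {u : ℝ} (hu : u < 0) : Real.log (Real.tanh (radius u / 2)) = u := by
  have h : radius u / 2 = Real.artanh (Real.exp u) := by unfold radius; ring
  rw [h, Real.tanh_artanh ⟨by linarith [Real.exp_pos u], by simpa using hu⟩, Real.log_exp]

/-- The discrete Gaussian curvature at `i` of the hyperbolic circle-packing metric on `T` with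
intersection angles `Φ` and discrete conformal factors `u`: `2π` minus the sum of the inner angles
at `i` over all faces at `i`. -/
def curvature (T : AbstractSimplicialComplex V) (Φ : Sym2 V → ℝ) (u : V → ℝ) (i : V) : ℝ :=
  2 * Real.pi - ∑ᶠ e ∈ oppositeEdges T i, innerAngle Φ (fun v => radius (u v)) i e

lemma oppositeEdges_finite {T : AbstractSimplicialComplex V} (hT : LocallyFinite T) (i : V) :
    (oppositeEdges T i).Finite := by
  have hA : (⋃ f ∈ {f : Finset V | f ∈ T.faces ∧ i ∈ f}, (f : Set V)).Finite :=
    (hT i).biUnion fun f _ => f.finite_toSet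
  refine ((hA.prod hA).image fun p => s(p.1, p.2)).subset ?_
  rintro e ⟨j, k, rfl, f, hf, -, h⟩
  have hi : i ∈ (f : Set V) := by simp [h]
  have hj : j ∈ (f : Set V) := by simp [h]
  have hk : k ∈ (f : Set V) := by simp [h]
  exact ⟨(j, k), ⟨Set.mem_biUnion (show f ∈ _ from ⟨hf, hi⟩) hj,
    Set.mem_biUnion (show f ∈ _ from ⟨hf, hi⟩) hk⟩, rfl⟩

end CirclePacking

end

/-!
Perron's method. By the explicit derivative of the law of cosines, the inner angle at `i` increases
with the radii at the other vertices, so the curvature at `i` decreases when `u` increases away from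
`i`: the inequality `K(u) ≤ K'` defines discrete subsolutions. The angles at `i` tend to `0` as
`r i → ∞`, uniformly in the other radii, so `K' i < 2π` keeps the subsolutions away from `0` at `i`.
Hence they have a supremum, which is again a subsolution by monotonicity and continuity; where it
failed to be a solution, raising its value at a single vertex would give a larger subsolution.
-/

open Function Set Filter Topology

namespace CirclePacking

lemma update_lt {ι α : Type*} [DecidableEq ι] [LT α] {u : ι → α} {c t : α} (i : ι)
    (hu : ∀ j, u j < c) (ht : t < c) (j : ι) : update u i t j < c := by
  rcases eq_or_ne j i with rfl | hj
  · rwa [update_self]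
  · rw [update_of_ne hj]
    exact hu j

section Perron

variable {ι α β : Type*} [DecidableEq ι] [LinearOrder α] [TopologicalSpace α] [LinearOrder β]
  [TopologicalSpace β]

/-- A discrete degenerate elliptic operator on the functions with values below `c`: its value at `i`
does not increase with the values of `u` away from `i` and depends continuously on `u i`. -/
structure IsElliptic (F : (ι → α) → ι → β) (c : α) : Prop where
  apply_le_apply : ∀ ⦃u v : ι → α⦄ ⦃i : ι⦄, (∀ j, v j < c) → u ≤ v → u i = v i → F v i ≤ F u i
  continuousOn_update : ∀ ⦃u : ι → α⦄ (i : ι), (∀ j, u j < c) →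
    ContinuousOn (fun t => F (update u i t) i) (Iio c)

/-- The subsolutions of `F u = κ` among the functions with values below `c`. -/
def subsolutions (F : (ι → α) → ι → β) (κ : ι → β) (c : α) : Set (ι → α) :=
  {u | (∀ i, u i < c) ∧ ∀ i, F u i ≤ κ i}

variable {F : (ι → α) → ι → β} {κ : ι → β} {c : α} {w : ι → α}

lemma IsElliptic.continuousAt_update [OrderClosedTopology α] (hF : IsElliptic F c)
    (hw : ∀ i, w i < c) (i : ι) : ContinuousAt (fun t => F (update w i t) i) (w i) :=
  (hF.continuousOn_update i hw).continuousAt (Iio_mem_nhds (hw i))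

lemma IsElliptic.mem_subsolutions_of_isLUB [OrderTopology α] [OrderClosedTopology β]
    (hF : IsElliptic F c) (hne : (subsolutions F κ c).Nonempty)
    (hlub : IsLUB (subsolutions F κ c) w) (hw : ∀ i, w i < c) : w ∈ subsolutions F κ c := by
  refine ⟨hw, fun i => ?_⟩
  have hwi : w i ∈ closure (eval i '' subsolutions F κ c) :=
    (isLUB_pi.1 hlub i).mem_closure (hne.image _)
  have hmaps : MapsTo (fun t => F (update w i t) i) (eval i '' subsolutions F κ c) (Iic (κ i)) := by
    rintro _ ⟨u, hu, rfl⟩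
    have hle : u ≤ update w i (u i) := le_update_iff.2 ⟨le_rfl, fun j _ => hlub.1 hu j⟩
    exact (hF.apply_le_apply (update_lt i hw (hu.1 i)) hle (by rw [update_self])).trans (hu.2 i)
  simpa using (hF.continuousAt_update hw i).continuousWithinAt.mem_closure hwi hmaps

lemma IsElliptic.eq_of_maximal_subsolution [OrderTopology α] [DenselyOrdered α]
    [OrderClosedTopology β] (hF : IsElliptic F c) (hw : Maximal (· ∈ subsolutions F κ c) w)
    (i : ι) : F w i = κ i := by
  obtain ⟨hneg, hle⟩ := hw.prop
  refine (hle i).eq_of_not_lt fun hlt => ?_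
  have hsmall : ∀ᶠ t in 𝓝 (w i), F (update w i t) i < κ i ∧ t < c :=
    ((hF.continuousAt_update hneg i).eventually_lt_const (by simpa using hlt)).and
      (Iio_mem_nhds (hneg i))
  have : (𝓝[>] w i).NeBot := nhdsGT_neBot_of_exists_gt ⟨c, hneg i⟩
  have hgt : ∀ᶠ t in 𝓝[>] w i, w i < t := self_mem_nhdsWithin
  obtain ⟨t, ⟨ht, htc⟩, hwt⟩ := ((hsmall.filter_mono nhdsWithin_le_nhds).and hgt).exists
  have hw_le : w ≤ update w i t := le_update_self_iff.2 hwt.le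
  have hmem : update w i t ∈ subsolutions F κ c := by
    refine ⟨update_lt i hneg htc, fun j => ?_⟩
    rcases eq_or_ne j i with rfl | hj
    · exact ht.le
    · exact (hF.apply_le_apply (update_lt i hneg htc) hw_le (update_of_ne hj ..).symm).trans (hle j)
  exact hwt.not_ge (by simpa using hw.le_of_ge hmem hw_le i)

end Perron

lemma IsElliptic.exists_eq {ι α β : Type*} [DecidableEq ι] [ConditionallyCompleteLinearOrder α]
    [TopologicalSpace α] [OrderTopology α] [DenselyOrdered α] [LinearOrder β] [TopologicalSpace β]
    [OrderClosedTopology β] {F : (ι → α) → ι → β} {κ : ι → β} {c : α} (hF : IsElliptic F c)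
    (hne : (subsolutions F κ c).Nonempty)
    (hbound : ∀ i, ∃ b < c, ∀ u ∈ subsolutions F κ c, u i ≤ b) :
    ∃ u : ι → α, (∀ i, u i < c) ∧ ∀ i, F u i = κ i := by
  choose b hbc hb using hbound
  have hub : b ∈ upperBounds (subsolutions F κ c) := fun u hu i => hb i u hu
  have hlub := isLUB_csSup hne ⟨b, hub⟩
  have hmem := hF.mem_subsolutions_of_isLUB hne hlub fun i => (hlub.2 hub i).trans_lt (hbc i)
  exact ⟨_, hmem.1, hF.eq_of_maximal_subsolution ⟨hmem, fun u hu _ => hlub.1 hu⟩⟩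

open Real

/-- The hyperbolic cosine of the length of an edge with radii `x`, `y` at its ends and intersection
angle of cosine `a`. -/
noncomputable def coshLength (a x y : ℝ) : ℝ := cosh x * cosh y + a * sinh x * sinh y

/-- The hyperbolic sine of the length of an edge with radii `x`, `y` at its ends and intersection
angle of cosine `a`. -/
noncomputable def sinhLength (a x y : ℝ) : ℝ := √(coshLength a x y ^ 2 - 1)

/-- The cosine of the inner angle at the vertex of radius `x` in a triangle with radii `x`, `y`,
`z`, where `a`, `b`, `c` are the cosines of the intersection angles on the edges `xy`, `yz`,
`xz`. -/
noncomputable def cosAngle (a b c x y z : ℝ) : ℝ :=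
  (coshLength a x y * coshLength c x z - coshLength b y z) / (sinhLength a x y * sinhLength c x z)

lemma coshLength_comm (a x y : ℝ) : coshLength a x y = coshLength a y x := by
  unfold coshLength
  ring

lemma cosAngle_comm (a b c x y z : ℝ) : cosAngle a b c x y z = cosAngle c b a x z y := by
  rw [cosAngle, cosAngle, coshLength_comm b, mul_comm (coshLength a x y),
    mul_comm (sinhLength a x y)]

variable {a b c m x y z : ℝ}

lemma one_lt_coshLength (ha : -1 < a) (hx : 0 < x) (hy : 0 < y) : 1 < coshLength a x y := by
  have hsinh : 0 < sinh x * sinh y := mul_pos (sinh_pos_iff.2 hx) (sinh_pos_iff.2 hy)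
  calc 1 ≤ cosh (x - y) := one_le_cosh _
    _ = cosh x * cosh y - sinh x * sinh y := cosh_sub x y
    _ < cosh x * cosh y + a * (sinh x * sinh y) := by nlinarith
    _ = coshLength a x y := by rw [coshLength, mul_assoc a]

lemma coshLength_sq_sub_one_pos (ha : -1 < a) (hx : 0 < x) (hy : 0 < y) :
    0 < coshLength a x y ^ 2 - 1 :=
  sub_pos.2 (one_lt_pow₀ (one_lt_coshLength ha hx hy) two_ne_zero)

lemma sinhLength_pos (ha : -1 < a) (hx : 0 < x) (hy : 0 < y) : 0 < sinhLength a x y :=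
  sqrt_pos.2 (coshLength_sq_sub_one_pos ha hx hy)

lemma sinhLength_le_coshLength (ha : -1 < a) (hx : 0 < x) (hy : 0 < y) :
    sinhLength a x y ≤ coshLength a x y :=
  (sqrt_le_left (one_pos.trans (one_lt_coshLength ha hx hy)).le).2 (sub_le_self _ zero_le_one)

lemma coshLength_le (ha : a ≤ 1) (hx : 0 ≤ x) (hy : 0 ≤ y) :
    coshLength a x y ≤ 2 * (cosh x * cosh y) := by
  calc coshLength a x y = cosh x * cosh y + a * (sinh x * sinh y) := by rw [coshLength, mul_assoc a]
    _ ≤ cosh x * cosh y + 1 * (sinh x * sinh y) := by gcongr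
    _ ≤ 2 * (cosh x * cosh y) := by linarith [cosh_sub x y, cosh_pos (x - y)]

lemma mul_cosh_mul_cosh_le_coshLength (hm : m ≤ 1) (hma : m ≤ 1 + a) (hx : 0 ≤ x) (hy : 0 ≤ y) :
    m * (cosh x * cosh y) ≤ coshLength a x y := by
  have hsinh : 0 ≤ sinh x * sinh y := mul_nonneg (sinh_nonneg_iff.2 hx) (sinh_nonneg_iff.2 hy)
  have hle : sinh x * sinh y ≤ cosh x * cosh y := by linarith [cosh_sub x y, cosh_pos (x - y)]
  unfold coshLength
  nlinarith [mul_nonneg (sub_nonneg.2 hm) (sub_nonneg.2 hle),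
    mul_nonneg (sub_nonneg.2 hma) hsinh]

lemma sqrt_mul_cosh_le_sinhLength (hm₀ : 0 ≤ m) (hm : m ≤ 1) (hma : m ≤ 1 + a) (hx : 0 ≤ x)
    (hy : 0 ≤ y) : √((m * cosh x) ^ 2 - 1) * cosh y ≤ sinhLength a x y := by
  rw [← sqrt_sq (cosh_pos y).le, ← sqrt_mul' _ (sq_nonneg _)]
  refine sqrt_le_sqrt ?_
  calc ((m * cosh x) ^ 2 - 1) * cosh y ^ 2 = (m * (cosh x * cosh y)) ^ 2 - cosh y ^ 2 := by ring
    _ ≤ coshLength a x y ^ 2 - 1 := by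
      gcongr
      · exact mul_cosh_mul_cosh_le_coshLength hm hma hx hy
      · exact one_le_pow₀ (one_le_cosh y)

lemma one_sub_le_cosAngle (hm : m ≤ 1) (hma : m ≤ 1 + a) (hmc : m ≤ 1 + c) (hb : b ≤ 1)
    (hx : 0 < x) (hy : 0 < y) (hz : 0 < z) (hmx : 1 < m * cosh x) :
    1 - 2 / ((m * cosh x) ^ 2 - 1) ≤ cosAngle a b c x y z := by
  have hm₀ : 0 < m := pos_of_mul_pos_left (one_pos.trans hmx) (cosh_pos x).le
  have hD : 0 < (m * cosh x) ^ 2 - 1 := sub_pos.2 (one_lt_pow₀ hmx two_ne_zero)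
  have ha : -1 < a := by linarith
  have hc : -1 < c := by linarith
  have hcosh : 0 < cosh y * cosh z := mul_pos (cosh_pos y) (cosh_pos z)
  have hsinh : 0 < sinhLength a x y * sinhLength c x z :=
    mul_pos (sinhLength_pos ha hx hy) (sinhLength_pos hc hx hz)
  have hden : sinhLength a x y * sinhLength c x z ≤ coshLength a x y * coshLength c x z :=
    mul_le_mul (sinhLength_le_coshLength ha hx hy) (sinhLength_le_coshLength hc hx hz)
      (sinhLength_pos hc hx hz).le (one_pos.trans (one_lt_coshLength ha hx hy)).le
  have hlow : ((m * cosh x) ^ 2 - 1) * (cosh y * cosh z) ≤ sinhLength a x y * sinhLength c x z :=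
    calc ((m * cosh x) ^ 2 - 1) * (cosh y * cosh z)
        = (√((m * cosh x) ^ 2 - 1) * cosh y) * (√((m * cosh x) ^ 2 - 1) * cosh z) := by
          rw [mul_mul_mul_comm, mul_self_sqrt hD.le]
      _ ≤ sinhLength a x y * sinhLength c x z := by
          gcongr
          · exact sqrt_nonneg _
          · exact sqrt_mul_cosh_le_sinhLength hm₀.le hm hma hx.le hy.le
          · exact sqrt_mul_cosh_le_sinhLength hm₀.le hm hmc hx.le hz.le
  calc 1 - 2 / ((m * cosh x) ^ 2 - 1)
      = 1 - 2 * (cosh y * cosh z) / (((m * cosh x) ^ 2 - 1) * (cosh y * cosh z)) := by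
        rw [mul_div_mul_right _ _ hcosh.ne']
    _ ≤ 1 - coshLength b y z / (sinhLength a x y * sinhLength c x z) := by
        gcongr
        exact coshLength_le hb hy.le hz.le
    _ ≤ cosAngle a b c x y z := by
        rw [cosAngle, sub_div]
        gcongr
        exact (one_le_div hsinh).2 hden

lemma tendsto_cosh_atTop : Tendsto cosh atTop atTop :=
  tendsto_atTop_mono (fun x => by linarith [cosh_eq x, exp_pos (-x)])
    (tendsto_exp_atTop.atTop_div_const two_pos)

lemma tendsto_arccos_cosAngle {ι : Type*} {l : Filter ι} {x y z : ι → ℝ} (ha : -1 < a)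
    (hb : b ≤ 1) (hc : -1 < c) (hx : Tendsto x l atTop) (hy : ∀ᶠ t in l, 0 < y t)
    (hz : ∀ᶠ t in l, 0 < z t) :
    Tendsto (fun t => arccos (cosAngle a b c (x t) (y t) (z t))) l (𝓝 0) := by
  obtain ⟨m, hm₀, hm⟩ : ∃ m, 0 < m ∧ m ≤ min 1 (min (1 + a) (1 + c)) :=
    ⟨_, by simp [neg_lt_iff_pos_add'.1 ha, neg_lt_iff_pos_add'.1 hc], le_rfl⟩
  obtain ⟨hm₁, hma, hmc⟩ : m ≤ 1 ∧ m ≤ 1 + a ∧ m ≤ 1 + c := by simpa only [le_min_iff] using hm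
  have hmx : Tendsto (fun t => m * cosh (x t)) l atTop :=
    (tendsto_cosh_atTop.comp hx).const_mul_atTop hm₀
  have hlim : Tendsto (fun t => 1 - 2 / ((m * cosh (x t)) ^ 2 - 1)) l (𝓝 (1 - 0)) :=
    tendsto_const_nhds.sub <| tendsto_const_nhds.div_atTop <|
      tendsto_atTop_add_const_right _ _ ((tendsto_pow_atTop two_ne_zero).comp hmx)
  have hupper := (continuous_arccos.tendsto _).comp hlim
  rw [sub_zero, arccos_one] at hupper
  refine tendsto_of_tendsto_of_tendsto_of_le_of_le' tendsto_const_nhds hupper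
    (.of_forall fun t => arccos_nonneg _) ?_
  filter_upwards [hx.eventually_gt_atTop 0, hy, hz, hmx.eventually_gt_atTop 1]
    with t hxt hyt hzt hmt
  exact antitone_arccos (one_sub_le_cosAngle hm₁ hma hmc hb hxt hyt hzt hmt)

lemma hasDerivAt_coshLength (a x y : ℝ) :
    HasDerivAt (fun t => coshLength a x t) (cosh x * sinh y + a * sinh x * cosh y) y :=
  ((hasDerivAt_cosh y).const_mul _).add ((hasDerivAt_sinh y).const_mul _)

lemma hasDerivAt_sinhLength (ha : -1 < a) (hx : 0 < x) (hy : 0 < y) :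
    HasDerivAt (fun t => sinhLength a x t)
      (coshLength a x y * (cosh x * sinh y + a * sinh x * cosh y) / sinhLength a x y) y := by
  refine ((((hasDerivAt_coshLength a x y).fun_pow 2).sub_const 1).sqrt
    (coshLength_sq_sub_one_pos ha hx hy).ne').congr_deriv ?_
  unfold sinhLength
  ring

lemma cosAngle_deriv_numerator (a b c x y z : ℝ) :
    (coshLength a x y * coshLength b y z - coshLength c x z) *
        (cosh x * sinh y + a * sinh x * cosh y) -
      (coshLength a x y ^ 2 - 1) * (cosh z * sinh y + b * sinh z * cosh y) =
      -(sinh x * ((1 - a ^ 2) * sinh x * sinh y * cosh z +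
        sinh z * ((b + a * c) * sinh x * cosh y + (c + a * b) * cosh x * sinh y))) := by
  unfold coshLength
  linear_combination
    ((cosh x * cosh y + a * sinh x * sinh y) * (a * sinh x * cosh z - b * cosh x * sinh z)) *
      cosh_sq y + (-sinh y * cosh z - b * cosh y * sinh z) * cosh_sq x

lemma hasDerivAt_cosAngle (b c z : ℝ) (ha : -1 < a) (hx : 0 < x) (hy : 0 < y) :
    HasDerivAt (fun t => cosAngle a b c x t z)
      (-(sinh x * ((1 - a ^ 2) * sinh x * sinh y * cosh z +
        sinh z * ((b + a * c) * sinh x * cosh y + (c + a * b) * cosh x * sinh y))) /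
        sinhLength a x y ^ 3 / sinhLength c x z) y := by
  have hp := (sinhLength_pos ha hx hy).ne'
  have hp_sq : sinhLength a x y ^ 2 = coshLength a x y ^ 2 - 1 :=
    sq_sqrt (coshLength_sq_sub_one_pos ha hx hy).le
  have hZ : HasDerivAt (fun t => coshLength b t z) (cosh z * sinh y + b * sinh z * cosh y) y := by
    simpa only [coshLength_comm b z] using hasDerivAt_coshLength b z y
  have hquot := ((((hasDerivAt_coshLength a x y).mul_const (coshLength c x z)).fun_sub hZ).fun_div
    (hasDerivAt_sinhLength ha hx hy) hp).div_const (sinhLength c x z)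
  simp only [cosAngle, ← div_div]
  refine hquot.congr_deriv ?_
  congr 1
  rw [← cosAngle_deriv_numerator, ← hp_sq]
  field_simp
  linear_combination (cosh x * sinh y + a * sinh x * cosh y) * coshLength c x z * hp_sq

lemma cosAngle_antitoneOn (ha : a ∈ Ioc (-1) 1) (hb : 0 ≤ b + a * c) (hc : 0 ≤ c + a * b)
    (hx : 0 < x) (hz : 0 < z) : AntitoneOn (fun y => cosAngle a b c x y z) (Ioi 0) := by
  have hderiv := fun y (hy : y ∈ Ioi (0 : ℝ)) => hasDerivAt_cosAngle b c z ha.1 hx hy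
  refine antitoneOn_of_hasDerivWithinAt_nonpos (convex_Ioi 0)
    (fun y hy => (hderiv y hy).continuousAt.continuousWithinAt)
    (fun y hy => (hderiv y (interior_subset hy)).hasDerivWithinAt) fun y hy => ?_
  rw [interior_Ioi, mem_Ioi] at hy
  have ha_sq : 0 ≤ 1 - a ^ 2 := by nlinarith [ha.1, ha.2]
  have hp : 0 ≤ sinhLength a x y := sqrt_nonneg _
  have hq : 0 ≤ sinhLength c x z := sqrt_nonneg _
  rw [neg_div, neg_div, neg_nonpos]
  positivity

lemma cosAngle_le_cosAngle {y' z' : ℝ} (ha : a ∈ Ioc (-1) 1) (hc : c ∈ Ioc (-1) 1)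
    (habc : 0 ≤ a + b * c) (hbac : 0 ≤ b + a * c) (hcab : 0 ≤ c + a * b) (hx : 0 < x) (hy : 0 < y)
    (hz : 0 < z) (hyy' : y ≤ y') (hzz' : z ≤ z') :
    cosAngle a b c x y' z' ≤ cosAngle a b c x y z := by
  have hy' : 0 < y' := hy.trans_le hyy'
  have hz' : 0 < z' := hz.trans_le hzz'
  calc cosAngle a b c x y' z' ≤ cosAngle a b c x y z' :=
        cosAngle_antitoneOn ha hbac hcab hx hz' hy hy' hyy'
    _ = cosAngle c b a x z' y := cosAngle_comm ..
    _ ≤ cosAngle c b a x z y :=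
        cosAngle_antitoneOn hc (mul_comm a c ▸ hbac) (mul_comm b c ▸ habc) hx hy hz hz' hzz'
    _ = cosAngle a b c x y z := cosAngle_comm ..

lemma continuousOn_cosAngle {X : Type*} [TopologicalSpace X] {s : Set X} {f g h : X → ℝ}
    (b : ℝ) (ha : -1 < a) (hc : -1 < c) (hf : ContinuousOn f s) (hg : ContinuousOn g s)
    (hh : ContinuousOn h s) (hf₀ : ∀ t ∈ s, 0 < f t) (hg₀ : ∀ t ∈ s, 0 < g t)
    (hh₀ : ∀ t ∈ s, 0 < h t) : ContinuousOn (fun t => cosAngle a b c (f t) (g t) (h t)) s := by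
  refine ContinuousOn.div ?_ ?_ fun t ht => (mul_pos (sinhLength_pos ha (hf₀ t ht) (hg₀ t ht))
    (sinhLength_pos hc (hf₀ t ht) (hh₀ t ht))).ne'
  all_goals simp only [sinhLength, coshLength]; fun_prop

lemma radius_le_radius {u v : ℝ} (hv : v < 0) (huv : u ≤ v) : radius u ≤ radius v :=
  mul_le_mul_of_nonneg_left (artanh_le_artanh (neg_one_lt_zero.trans (exp_pos u))
    (exp_lt_one_iff.2 hv) (exp_le_exp.2 huv)) zero_le_two

lemma radius_eq_log {u : ℝ} (hu : u < 0) : radius u = log ((1 + exp u) / (1 - exp u)) := by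
  have hmem : exp u ∈ Icc (-1) 1 := ⟨by linarith [exp_pos u], (exp_lt_one_iff.2 hu).le⟩
  rw [radius, artanh_eq_half_log hmem]
  ring

lemma continuousOn_radius : ContinuousOn radius (Iio 0) := by
  have hden : ∀ u ∈ Iio (0 : ℝ), 0 < 1 - exp u := fun u hu => sub_pos.2 (exp_lt_one_iff.2 hu)
  have hlog : ContinuousOn (fun u => log ((1 + exp u) / (1 - exp u))) (Iio 0) :=
    ContinuousOn.log (ContinuousOn.div (by fun_prop) (by fun_prop) fun u hu => (hden u hu).ne')
      fun u hu => (div_pos (by positivity) (hden u hu)).ne'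
  exact hlog.congr fun u hu => radius_eq_log hu

lemma tendsto_radius_nhdsLT_zero : Tendsto radius (𝓝[<] 0) atTop := by
  have hnum : Tendsto (fun u => 1 + exp u) (𝓝[<] 0) (𝓝 2) :=
    ((by fun_prop : Continuous fun u => 1 + exp u).tendsto' 0 2 (by norm_num)).mono_left
      nhdsWithin_le_nhds
  have hden : Tendsto (fun u => 1 - exp u) (𝓝[<] 0) (𝓝[>] 0) :=
    tendsto_nhdsWithin_iff.2
      ⟨((by fun_prop : Continuous fun u => 1 - exp u).tendsto' 0 0 (by simp)).mono_left
        nhdsWithin_le_nhds,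
      eventually_mem_nhdsWithin.mono fun u hu => sub_pos.2 (exp_lt_one_iff.2 hu)⟩
  have hlog : Tendsto (fun u => log ((1 + exp u) / (1 - exp u))) (𝓝[<] 0) atTop :=
    tendsto_log_atTop.comp (hnum.pos_mul_atTop two_pos hden.inv_tendsto_nhdsGT_zero)
  exact hlog.congr' (eventually_mem_nhdsWithin.mono fun u hu => (radius_eq_log hu).symm)

variable {V : Type*} {T : AbstractSimplicialComplex V} {Φ : Sym2 V → ℝ} {i j k : V}

/-- Zhou's condition on the exterior intersection angles of a circle packing. It holds for angles in
`[0, π / 2]` and also allows obtuse ones. In each face it makes the inner angle at a vertex increase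
with the radii at the two other vertices. -/
def AdmissibleAngles (T : AbstractSimplicialComplex V) (Φ : Sym2 V → ℝ) : Prop :=
  ∀ ⦃i j k⦄, IsTriangle T i j k →
    -1 < cos (Φ s(i, j)) ∧ 0 ≤ cos (Φ s(i, j)) + cos (Φ s(j, k)) * cos (Φ s(i, k))

lemma IsTriangle.rotate (h : IsTriangle T i j k) : IsTriangle T j k i := by
  obtain ⟨f, hf, hcard, hfe⟩ := h
  exact ⟨f, hf, hcard, by rw [hfe, insert_comm, pair_comm i k]⟩

lemma IsTriangle.swap (h : IsTriangle T i j k) : IsTriangle T i k j := by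
  obtain ⟨f, hf, hcard, hfe⟩ := h
  exact ⟨f, hf, hcard, by rw [hfe, pair_comm j k]⟩

lemma IsTriangle.adj (h : IsTriangle T i j k) : (skeleton T).Adj i j := by
  classical
  obtain ⟨f, hf, hcard, hfe⟩ := h
  refine ⟨?_, {i, j}, (T.isRelLowerSet_faces hf).2 ?_ (by simp), by simp⟩
  · rintro rfl
    have hpair : f = {i, k} := Finset.coe_injective (by simpa using hfe)
    exact (hcard ▸ hpair ▸ Finset.card_le_two : 3 ≤ 2).not_gt (by norm_num)
  · rw [← Finset.coe_subset, hfe]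
    simp [insert_subset_iff]

lemma admissibleAngles_of_mem_Icc
    (hΦ : ∀ e ∈ (skeleton T).edgeSet, Φ e ∈ Icc 0 (π / 2)) : AdmissibleAngles T Φ := by
  have hcos : ∀ ⦃i j⦄, (skeleton T).Adj i j → 0 ≤ cos (Φ s(i, j)) := fun i j h =>
    cos_nonneg_of_mem_Icc (Icc_subset_Icc_left (by linarith [pi_pos]) (hΦ s(i, j) h))
  intro i j k h
  exact ⟨neg_one_lt_zero.trans_le (hcos h.adj),
    add_nonneg (hcos h.adj) (mul_nonneg (hcos h.rotate.adj) (hcos h.swap.adj))⟩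

lemma innerAngle_mk {r : V → ℝ} (hΦ : AdmissibleAngles T Φ) (h : IsTriangle T i j k)
    (hr : ∀ v, 0 < r v) : innerAngle Φ r i s(j, k) = arccos
      (cosAngle (cos (Φ s(i, j))) (cos (Φ s(j, k))) (cos (Φ s(i, k))) (r i) (r j) (r k)) := by
  have hcosh : ∀ {v w t}, IsTriangle T v w t → 1 ≤ coshLength (cos (Φ s(v, w))) (r v) (r w) :=
    fun h => (one_lt_coshLength (hΦ h).1 (hr _) (hr _)).le
  have hedge : ∀ v w, edgeLength Φ r v w = arcosh (coshLength (cos (Φ s(v, w))) (r v) (r w)) :=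
    fun _ _ => rfl
  simp only [innerAngle, Sym2.lift_mk, hyperbolicAngle, hedge, cosh_arcosh (hcosh h),
    cosh_arcosh (hcosh h.rotate), cosh_arcosh (hcosh h.swap), sinh_arcosh (hcosh h),
    sinh_arcosh (hcosh h.swap), cosAngle, sinhLength]

variable {e : Sym2 V}

lemma innerAngle_le_innerAngle {r s : V → ℝ} (hΦ : AdmissibleAngles T Φ)
    (he : e ∈ oppositeEdges T i) (hr : ∀ v, 0 < r v) (hrs : r ≤ s) (hi : r i = s i) :
    innerAngle Φ r i e ≤ innerAngle Φ s i e := by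
  obtain ⟨j, k, rfl, h⟩ := he
  have hjk := (hΦ h.rotate).2
  have hik := (hΦ h.swap).2
  rw [Sym2.eq_swap (a := k) (b := i), Sym2.eq_swap (a := j) (b := i), mul_comm] at hjk
  rw [Sym2.eq_swap (a := k) (b := j), mul_comm] at hik
  rw [innerAngle_mk hΦ h hr, innerAngle_mk hΦ h fun v => (hr v).trans_le (hrs v), ← hi]
  exact antitone_arccos <| cosAngle_le_cosAngle ⟨(hΦ h).1, cos_le_one _⟩
    ⟨(hΦ h.swap).1, cos_le_one _⟩ (hΦ h).2 hjk hik (hr i) (hr j) (hr k) (hrs j) (hrs k)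

lemma continuousOn_innerAngle (hΦ : AdmissibleAngles T Φ) (he : e ∈ oppositeEdges T i) :
    ContinuousOn (fun r => innerAngle Φ r i e) {r | ∀ v, 0 < r v} := by
  obtain ⟨j, k, rfl, h⟩ := he
  have hcos : ContinuousOn (fun r : V → ℝ =>
      cosAngle (cos (Φ s(i, j))) (cos (Φ s(j, k))) (cos (Φ s(i, k))) (r i) (r j) (r k))
      {r | ∀ v, 0 < r v} :=
    continuousOn_cosAngle _ (hΦ h).1 (hΦ h.swap).1 (by fun_prop) (by fun_prop) (by fun_prop)
      (fun _ hr => hr i) (fun _ hr => hr j) (fun _ hr => hr k)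
  exact (continuous_arccos.comp_continuousOn hcos).congr fun r hr => innerAngle_mk hΦ h hr

lemma tendsto_innerAngle (hΦ : AdmissibleAngles T Φ) (he : e ∈ oppositeEdges T i) :
    Tendsto (fun r => innerAngle Φ r i e)
      (comap (eval i) atTop ⊓ 𝓟 {r | ∀ v, 0 < r v}) (𝓝 0) := by
  obtain ⟨j, k, rfl, h⟩ := he
  have hpos : ∀ᶠ r : V → ℝ in comap (eval i) atTop ⊓ 𝓟 {r | ∀ v, 0 < r v}, ∀ v, 0 < r v :=
    mem_inf_of_right (mem_principal_self _)
  exact (tendsto_arccos_cosAngle (hΦ h).1 (cos_le_one (Φ s(j, k))) (hΦ h.swap).1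
    (tendsto_comap.mono_left inf_le_left) (hpos.mono fun r hr => hr j)
    (hpos.mono fun r hr => hr k)).congr' (hpos.mono fun r hr => (innerAngle_mk hΦ h hr).symm)

lemma curvature_eq_sub_sum (hT : LocallyFinite T) (Φ : Sym2 V → ℝ) (u : V → ℝ) (i : V) :
    curvature T Φ u i = 2 * π -
      ∑ e ∈ (oppositeEdges_finite hT i).toFinset, innerAngle Φ (fun v => radius (u v)) i e := by
  rw [curvature, finsum_mem_eq_finite_toFinset_sum _ (oppositeEdges_finite hT i)]

lemma curvature_le_curvature (hT : LocallyFinite T) (hΦ : AdmissibleAngles T Φ) {u v : V → ℝ}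
    (hv : ∀ j, v j < 0) (huv : u ≤ v) (hi : u i = v i) :
    curvature T Φ v i ≤ curvature T Φ u i := by
  rw [curvature_eq_sub_sum hT, curvature_eq_sub_sum hT]
  gcongr with e he
  exact innerAngle_le_innerAngle hΦ ((Set.Finite.mem_toFinset _).1 he)
    (fun j => radius_pos ((huv j).trans_lt (hv j)))
    (fun j => radius_le_radius (hv j) (huv j)) (congrArg radius hi)

lemma continuousOn_curvature (hT : LocallyFinite T) (hΦ : AdmissibleAngles T Φ) (i : V) :
    ContinuousOn (fun u => curvature T Φ u i) {u | ∀ j, u j < 0} := by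
  simp only [curvature_eq_sub_sum hT]
  have hradius : ContinuousOn (fun (u : V → ℝ) v => radius (u v)) {u | ∀ j, u j < 0} :=
    continuousOn_pi.2 fun v => continuousOn_radius.comp (continuousOn_apply v _) fun u hu => hu v
  exact continuousOn_const.sub <| continuousOn_finsetSum _ fun e he =>
    (continuousOn_innerAngle hΦ ((Set.Finite.mem_toFinset _).1 he)).comp hradius
      fun u hu v => radius_pos (hu v)

lemma isElliptic_curvature [DecidableEq V] (hT : LocallyFinite T) (hΦ : AdmissibleAngles T Φ) :
    IsElliptic (curvature T Φ) 0 where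
  apply_le_apply _ _ _ := curvature_le_curvature hT hΦ
  continuousOn_update u i hu := by
    have hupdate : Continuous (update u i) := continuous_const.update i continuous_id
    exact (continuousOn_curvature hT hΦ i).comp hupdate.continuousOn fun _ ht => update_lt i hu ht

lemma tendsto_curvature (hT : LocallyFinite T) (hΦ : AdmissibleAngles T Φ) (i : V) :
    Tendsto (fun u => curvature T Φ u i)
      (comap (eval i) (𝓝[<] 0) ⊓ 𝓟 {u | ∀ j, u j < 0}) (𝓝 (2 * π)) := by
  have hpos : MapsTo (fun (u : V → ℝ) v => radius (u v)) {u | ∀ j, u j < 0} {r | ∀ v, 0 < r v} :=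
    fun u hu v => radius_pos (hu v)
  have hradius : Tendsto (fun (u : V → ℝ) v => radius (u v)) (comap (eval i) (𝓝[<] 0))
      (comap (eval i) atTop) :=
    tendsto_comap_iff.2 (tendsto_radius_nhdsLT_zero.comp tendsto_comap)
  have hsum := tendsto_finsetSum (oppositeEdges_finite hT i).toFinset fun e he =>
    (tendsto_innerAngle hΦ ((Set.Finite.mem_toFinset _).1 he)).comp (hradius.inf hpos.tendsto)
  simp only [curvature_eq_sub_sum hT]
  simpa using tendsto_const_nhds.sub hsum

lemma exists_forall_mem_subsolutions_curvature_le {κ : V → ℝ} (hT : LocallyFinite T)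
    (hΦ : AdmissibleAngles T Φ) (hκ : κ i < 2 * π) :
    ∃ b < 0, ∀ u ∈ subsolutions (curvature T Φ) κ 0, u i ≤ b := by
  have hlt := (tendsto_curvature hT hΦ i).eventually_const_lt hκ
  obtain ⟨s, hs, hsub⟩ := mem_comap.1 (mem_inf_principal.1 hlt)
  obtain ⟨b, hb, hbs⟩ := mem_nhdsLT_iff_exists_Ioo_subset.1 hs
  refine ⟨b, hb, fun u hu => le_of_not_gt fun hbu => (hu.2 i).not_gt ?_⟩
  exact hsub (hbs ⟨hbu, hu.1 i⟩ : u i ∈ s) hu.1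

end CirclePacking

theorem theorem4p3_general {V : Type*} {T : AbstractSimplicialComplex V}
    (hT : CirclePacking.LocallyFinite T) {Φ : Sym2 V → ℝ}
    (hΦ : CirclePacking.AdmissibleAngles T Φ) {u₀ : V → ℝ} (hu₀ : ∀ i, u₀ i < 0) {K' : V → ℝ}
    (hK' : ∀ i, CirclePacking.curvature T Φ u₀ i ≤ K' i ∧ K' i < 2 * Real.pi) :
    ∃ u : V → ℝ, (∀ i, u i < 0) ∧ ∀ i, CirclePacking.curvature T Φ u i = K' i := by
  classical
  exact (CirclePacking.isElliptic_curvature hT hΦ).exists_eq ⟨u₀, hu₀, fun i => (hK' i).1⟩ fun i =>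
    CirclePacking.exists_forall_mem_subsolutions_curvature_le hT hΦ (hK' i).2

theorem theorem4p3 {V : Type*} (T : AbstractSimplicialComplex V)
    (hT : CirclePacking.IsInfiniteDiskTriangulation T)
    (Φ : Sym2 V → ℝ)
    (hΦ : ∀ e ∈ (CirclePacking.skeleton T).edgeSet, Φ e ∈ Set.Icc 0 (Real.pi / 2))
    (u₀ : V → ℝ) (hu₀ : ∀ i, u₀ i < 0)
    (K' : V → ℝ)
    (hK' : ∀ i, CirclePacking.curvature T Φ u₀ i ≤ K' i ∧ K' i < 2 * Real.pi) :
    ∃ u : V → ℝ, (∀ i, u i < 0) ∧ ∀ i, CirclePacking.curvature T Φ u i = K' i :=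
  theorem4p3_general hT.locallyFinite (CirclePacking.admissibleAngles_of_mem_Icc hΦ) hu₀ hK'
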